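/- Let $G$ be a (finite-dimensional, real) Lie group with Lie algebra $\mathfrak g=T_1G$, whose elements $v$ are identified with right-invariant vector fields, so that $[u,v]$ is the value at $1$ of the Lie bracket of $u_r$ and $v_r$; here $v_r,v_l$ denote the right- and left-invariant vector fields with value $v$ at $1$, and $r_g,l_g$ are right and left translation. Let $(\cdot,\cdot)_{\mathfrak g}$ be an $\mathrm{Ad}(G)$-invariant nondegenerate symmetric bilinear form on $\mathfrak g$. It induces a bi-invariant form on $TG$, and $^\vee$ denotes the induced identifications $\mathfrak g\cong\mathfrak g^*$ and $TG\cong T^*G$. Let $\chi_G\in\Lambda^3\mathfrak g$ be given by $\chi_G(u^\vee,v^\vee,w^\vee)=\tfrac12(u,[v,w])_{\mathfrak g}$, and, for $v\in\mathfrak g$, $V\in T_gG$, $\xi\in T_g^*G$, put $$\rho(v)=v_r-v_l,\quad \sigma(v)=\tfrac12(v_r+v_l)^\vee,\quad \rho^\vee(V)=dr_{g^{-1}}V-dl_{g^{-1}}V,\quad \sigma^\vee(\xi)=\tfrac12\bigl(dr_{g^{-1}}\xi^\vee+dl_{g^{-1}}\xi^\vee\bigr).$$ A quasi-Poisson $\mathfrak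 g$-manifold is a smooth manifold $M$ with a $\mathfrak g$-action, i.e. a Lie algebra homomorphism $\rho_M:\mathfrak g\to\mathcal X(M)$, and a $\mathfrak g$-invariant bivector field $\pi$ such that $\chi_\pi=\rho_M(\chi_G)$, where, with $\{f,h\}=\pi(df,dh)$, the trivector field $\chi_\pi$ is determined by $\tfrac12\chi_\pi(df,dh,dk)=\{f,\{h,k\}\}+\{h,\{k,f\}\}+\{k,\{f,h\}\}$. Write $\beta(\pi^\sharp\alpha)=\pi(\alpha,\beta)$. It is hamiltonian with moment map a smooth map $J:M\to G$ if $dJ\circ\rho_M=\rho$ and $\pi^\sharp J^*=\rho_M\sigma^\vee$ on $T^*G$. Put $C=1-\tfrac14\rho_M\,\rho^\vee\,dJ:TM\to TM$. The Dirac structure corresponding to $\pi$ is $$L=\{(\pi^\sharp(\alpha)+\rho_M(v),\;C^*\alpha+J^*\sigma(v)) : \alpha\in T^*M,\ v\in\mathfrak g\}\subset TM\oplus T^*M.$$ Let $(M_1,\pi_1)$ and $(M_2,\pi_2)$ be hamiltonian quasi-Poisson $\mathfrak g$-manifolds (for the same $G$ and $(\cdot,\cdot)_{\mathfrak g}$)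 with actions $\rho_1,\rho_2$, moment maps $J_1,J_2$ and corresponding Dirac structures $L_1,L_2$, and let $f:M_1\to M_2$ be a smooth map. Then the following are equivalent: (a) $f$ is a hamiltonian quasi-Poisson map: $f_*\pi_1=\pi_2$ (that is, $\pi_1(df_x^*\alpha,df_x^*\beta)=\pi_2(\alpha,\beta)$ for all $x\in M_1$ and $\alpha,\beta\in T^*_{f(x)}M_2$), $f$ is $\mathfrak g$-equivariant ($df\circ\rho_1=\rho_2$), and $J_2\circ f=J_1$; (b) $f:(M_1,L_1)\to(M_2,L_2)$ is forward Dirac, i.e. $(L_2)_{f(x)}=\{(df_x(Y),\alpha) : Y\in T_xM_1,\ \alpha\in T^*_{f(x)}M_2,\ (Y,df_x^*\alpha)\in (L_1)_x\}$ for every $x\in M_1$, and $J_2\circ f=J_1$. -/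

import Mathlib

open scoped Manifold ContDiff

noncomputable section

namespace QuasiPoisson

section Covectors

variable {E H : Type*} [NormedAddCommGroup E] [NormedSpace ℝ E] [TopologicalSpace H]
  (I : ModelWithCorners ℝ E H) {M : Type*} [TopologicalSpace M] [ChartedSpace H M]
  {E' H' : Type*} [NormedAddCommGroup E'] [NormedSpace ℝ E'] [TopologicalSpace H']
  (I' : ModelWithCorners ℝ E' H') {M' : Type*} [TopologicalSpace M'] [ChartedSpace H' M']

/-- The cotangent space `T*_x M`. -/
abbrev Cotangent (x : M) : Type _ := TangentSpace I x →L[ℝ] ℝ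

/-- The differential `dh_x ∈ T*_x M` of a real function. -/
def differential (h : M → ℝ) (x : M) : Cotangent I x := mfderiv I 𝓘(ℝ, ℝ) h x

/-- The pull-back `(df_x)^* : T*_{f x} M' → T*_x M`, `α ↦ α ∘ df_x`. -/
def codifferential (f : M → M') (x : M) (α : Cotangent I' (f x)) : Cotangent I x :=
  α.comp (mfderiv I I' f x)

end Covectors

section Group

variable {E H : Type*} [NormedAddCommGroup E] [NormedSpace ℝ E] [TopologicalSpace H]
  (I : ModelWithCorners ℝ E H) {G : Type*} [TopologicalSpace G] [ChartedSpace H G] [Group G]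

/-- The differential `dr_g : 𝔤 = T_1 G → T_g G` of the right translation `h ↦ h g`. -/
def rightTrans (g : G) : GroupLieAlgebra I G →L[ℝ] TangentSpace I g :=
  mfderiv I I (fun h : G => h * g) 1

/-- The differential `dl_g : 𝔤 = T_1 G → T_g G` of the left translation `h ↦ g h`. -/
def leftTrans (g : G) : GroupLieAlgebra I G →L[ℝ] TangentSpace I g :=
  mfderiv I I (fun h : G => g * h) 1

/-- The differential `dr_{g⁻¹} : T_g G → T_1 G = 𝔤`. -/
def rightTransInv (g : G) : TangentSpace I g →L[ℝ] GroupLieAlgebra I G :=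
  mfderiv I I (fun h : G => h * g⁻¹) g

/-- The differential `dl_{g⁻¹} : T_g G → T_1 G = 𝔤`. -/
def leftTransInv (g : G) : TangentSpace I g →L[ℝ] GroupLieAlgebra I G :=
  mfderiv I I (fun h : G => g⁻¹ * h) g

/-- The adjoint action `Ad_g`, the differential at `1` of `h ↦ g h g⁻¹`. -/
def adjointAction (g : G) : GroupLieAlgebra I G →L[ℝ] GroupLieAlgebra I G :=
  mfderiv I I (fun h : G => g * h * g⁻¹) 1

/-- The bracket of `𝔤` when its elements are identified with *right*-invariant vector fields:
the value at `1` of the Lie bracket of the vector fields `u_r` and `v_r`. -/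
def rightBracket (u v : GroupLieAlgebra I G) : GroupLieAlgebra I G :=
  VectorField.mlieBracket I (fun g : G => rightTrans I g u) (fun g : G => rightTrans I g v) (1 : G)

/-- The infinitesimal conjugation action `ρ(v) = v_r - v_l` of `𝔤` on `G`, at the point `g`. -/
def conjugation (g : G) : GroupLieAlgebra I G →L[ℝ] TangentSpace I g :=
  rightTrans I g - leftTrans I g

/-- `ρ^∨(V) = dr_{g⁻¹}(V) - dl_{g⁻¹}(V)` for `V ∈ T_g G`. -/
def conjugationDual (g : G) : TangentSpace I g →L[ℝ] GroupLieAlgebra I G :=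
  rightTransInv I g - leftTransInv I g

variable (G) in
/-- A bi-invariant nondegenerate quadratic form on `G`, given by the corresponding
`Ad(G)`-invariant nondegenerate symmetric bilinear form on `𝔤`. -/
structure InvariantForm where
  /-- the bilinear form `(·,·)_𝔤` -/
  form : LinearMap.BilinForm ℝ (GroupLieAlgebra I G)
  symm : ∀ u v, form u v = form v u
  nondegenerate : form.Nondegenerate
  invariant : ∀ (g : G) (u v : GroupLieAlgebra I G),
    form (adjointAction I g u) (adjointAction I g v) = form u v

variable {I}

namespace InvariantForm

variable [FiniteDimensional ℝ E] (B : InvariantForm I G)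

/-- The element `μ^∨ ∈ 𝔤` dual to `μ ∈ 𝔤*`: `(μ^∨, v) = μ(v)` for all `v`. -/
def dualElement (μ : GroupLieAlgebra I G →L[ℝ] ℝ) : GroupLieAlgebra I G :=
  haveI : FiniteDimensional ℝ (GroupLieAlgebra I G) := inferInstanceAs (FiniteDimensional ℝ E)
  (B.form.toDual B.nondegenerate).symm μ.toLinearMap

/-- The covector `V^∨ ∈ T*_g G` dual to `V ∈ T_g G` for the bi-invariant form
`(V, W)_g = (dr_{g⁻¹} V, dr_{g⁻¹} W)_𝔤` on `T_g G`. -/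
def lower (g : G) (V : TangentSpace I g) : Cotangent I g :=
  haveI : FiniteDimensional ℝ (GroupLieAlgebra I G) := inferInstanceAs (FiniteDimensional ℝ E)
  haveI : T2Space (GroupLieAlgebra I G) := inferInstanceAs (T2Space E)
  (LinearMap.toContinuousLinearMap (B.form (rightTransInv I g V))).comp (rightTransInv I g)

/-- The vector `ξ^∨ ∈ T_g G` dual to `ξ ∈ T*_g G` for the bi-invariant form on `T_g G`. -/
def raise (g : G) (ξ : Cotangent I g) : TangentSpace I g :=
  rightTrans I g (B.dualElement (ξ.comp (rightTrans I g)))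

/-- `σ(v) = ½ (v_r + v_l)^∨ ∈ T*_g G`. -/
def sigma (g : G) (v : GroupLieAlgebra I G) : Cotangent I g :=
  (1 / 2 : ℝ) • B.lower g (rightTrans I g v + leftTrans I g v)

theorem sigma_apply (g : G) (v : GroupLieAlgebra I G) (W : TangentSpace I g) :
    B.sigma g v W = (1 / 2 : ℝ) *
      B.form (rightTransInv I g (rightTrans I g v + leftTrans I g v)) (rightTransInv I g W) :=
  rfl

theorem sigma_add (g : G) (u v : GroupLieAlgebra I G) :
    B.sigma g (u + v) = B.sigma g u + B.sigma g v := by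
  ext W
  simp only [sigma_apply, _root_.add_apply, map_add, LinearMap.add_apply]
  ring

theorem sigma_smul (g : G) (c : ℝ) (v : GroupLieAlgebra I G) :
    B.sigma g (c • v) = c • B.sigma g v := by
  ext W
  simp only [sigma_apply, _root_.smul_apply, map_add, map_smul, LinearMap.add_apply,
    LinearMap.smul_apply, smul_eq_mul]
  ring

/-- `σ^∨(ξ) = ½ (dr_{g⁻¹}(ξ^∨) + dl_{g⁻¹}(ξ^∨)) ∈ 𝔤`. -/
def sigmaDual (g : G) (ξ : Cotangent I g) : GroupLieAlgebra I G :=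
  (1 / 2 : ℝ) • (rightTransInv I g (B.raise g ξ) + leftTransInv I g (B.raise g ξ))

/-- The trivector of `𝔤` dual to the Cartan 3-form `½ (u, [v, w])_𝔤`, as a trilinear form
on `𝔤*`. -/
def cartanTrivector (μ ν τ : GroupLieAlgebra I G →L[ℝ] ℝ) : ℝ :=
  (1 / 2 : ℝ) *
    B.form (B.dualElement μ) (rightBracket I (B.dualElement ν) (B.dualElement τ))

end InvariantForm

end Group

section Structures

variable {EG HG : Type*} [NormedAddCommGroup EG] [NormedSpace ℝ EG] [TopologicalSpace HG]
  (IG : ModelWithCorners ℝ EG HG) (G : Type*) [TopologicalSpace G] [ChartedSpace HG G] [Group G]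
  {E H : Type*} [NormedAddCommGroup E] [NormedSpace ℝ E] [TopologicalSpace H]
  (I : ModelWithCorners ℝ E H) (M : Type*) [TopologicalSpace M] [ChartedSpace H M]
  [IsManifold I ∞ M]

/-- An infinitesimal action of `𝔤` on `M`: a Lie algebra homomorphism `𝔤 → 𝒳(M)` into the smooth
vector fields. -/
structure InfinitesimalAction where
  /-- the bundle map `ρ_M : 𝔤 → T_x M` -/
  toFun : (x : M) → GroupLieAlgebra IG G →L[ℝ] TangentSpace I x
  smooth : ∀ v : GroupLieAlgebra IG G,
    ContMDiff I I.tangent ∞ (fun x : M => (⟨x, toFun x v⟩ : TangentBundle I M))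
  map_bracket : ∀ (u v : GroupLieAlgebra IG G) (x : M),
    toFun x (rightBracket IG u v) =
      VectorField.mlieBracket I (fun y => toFun y u) (fun y => toFun y v) x

/-- A smooth bivector field `π` on `M`, given by the skew-symmetric bundle map
`π^♯ : T*M → TM`, `β(π^♯ α) = π(α, β)`. -/
structure BivectorField where
  /-- the bundle map `π^♯` -/
  sharp : (x : M) → Cotangent I x →L[ℝ] TangentSpace I x
  skew : ∀ (x : M) (α β : Cotangent I x), β (sharp x α) = -α (sharp x β)
  smooth : ContMDiff I (I.prod 𝓘(ℝ, (E →L[ℝ] ℝ) →L[ℝ] E)) ∞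
    (fun x : M => Bundle.TotalSpace.mk' ((E →L[ℝ] ℝ) →L[ℝ] E)
      (E := fun y : M => ((TangentSpace I y) →L[ℝ] (Bundle.Trivial M ℝ y)) →L[ℝ] TangentSpace I y)
      x (sharp x))

variable {IG G I M}

/-- The value `π(α, β)`. -/
def BivectorField.eval (π : BivectorField I M) (x : M) (α β : Cotangent I x) : ℝ :=
  β (π.sharp x α)

/-- The bracket `{f, h} = π(df, dh)` of functions. -/
def BivectorField.bracket (π : BivectorField I M) (f h : M → ℝ) : M → ℝ :=
  fun x => π.eval x (differential I f x) (differential I h x)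

/-- The derivative `ℒ_{ρ_M(v)} f` of a function along the vector field `ρ_M(v)`. -/
def InfinitesimalAction.lieDerivative (ρ : InfinitesimalAction IG G I M)
    (v : GroupLieAlgebra IG G) (f : M → ℝ) : M → ℝ :=
  fun x => differential I f x (ρ.toFun x v)

variable [FiniteDimensional ℝ EG]

variable (I M) in
/-- A quasi-Poisson `𝔤`-manifold structure on `M`: a `𝔤`-action together with a bivector field `π`
that is `𝔤`-invariant and satisfies `χ_π = ρ_M(χ_G)`, where `χ_G ∈ Λ³𝔤` is the Cartan trivector and
`χ_π = [π, π]` is the trivector field with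
`½ χ_π(df, dh, dk) = {f, {h, k}} + {h, {k, f}} + {k, {f, h}}`. -/
structure QuasiPoissonManifold (B : InvariantForm IG G) where
  action : InfinitesimalAction IG G I M
  bivector : BivectorField I M
  /-- `ℒ_{ρ_M(v)} π = 0` -/
  invariant : ∀ (v : GroupLieAlgebra IG G) (f h : M → ℝ),
    ContMDiff I 𝓘(ℝ, ℝ) ∞ f → ContMDiff I 𝓘(ℝ, ℝ) ∞ h → ∀ x,
    action.lieDerivative v (bivector.bracket f h) x =
      bivector.bracket (action.lieDerivative v f) h x +
        bivector.bracket f (action.lieDerivative v h) x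
  /-- `χ_π = ρ_M(χ_G)` -/
  quasiJacobi : ∀ f h k : M → ℝ,
    ContMDiff I 𝓘(ℝ, ℝ) ∞ f → ContMDiff I 𝓘(ℝ, ℝ) ∞ h → ContMDiff I 𝓘(ℝ, ℝ) ∞ k → ∀ x,
    2 * (bivector.bracket f (bivector.bracket h k) x +
        bivector.bracket h (bivector.bracket k f) x +
        bivector.bracket k (bivector.bracket f h) x) =
      B.cartanTrivector ((differential I f x).comp (action.toFun x))
        ((differential I h x).comp (action.toFun x)) ((differential I k x).comp (action.toFun x))

variable (I M) in
/-- A hamiltonian quasi-Poisson `𝔤`-manifold: a quasi-Poisson `𝔤`-manifold with a moment map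
`J : M → G`. -/
structure HamiltonianQuasiPoissonManifold (B : InvariantForm IG G) extends
    QuasiPoissonManifold I M B where
  /-- the moment map `J` -/
  moment : C^∞⟮I, M; IG, G⟯
  /-- `dJ (ρ_M(v)) = v_r - v_l` -/
  equivariant : ∀ (x : M) (v : GroupLieAlgebra IG G),
    mfderiv I IG moment x (action.toFun x v) = conjugation IG (moment x) v
  /-- `π^♯ J^* = ρ_M σ^∨` -/
  moment_condition : ∀ (x : M) (ξ : Cotangent IG (moment x)),
    bivector.sharp x (codifferential I IG moment x ξ) =
      action.toFun x (B.sigmaDual (moment x) ξ)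

namespace HamiltonianQuasiPoissonManifold

variable {B : InvariantForm IG G} (P : HamiltonianQuasiPoissonManifold I M B)

/-- The operator `C = 1 - ¼ ρ_M ρ^∨ dJ : T_x M → T_x M`. -/
def operatorC (x : M) : TangentSpace I x →L[ℝ] TangentSpace I x :=
  ContinuousLinearMap.id ℝ (TangentSpace I x) -
    (1 / 4 : ℝ) • (P.action.toFun x).comp
      ((conjugationDual IG (P.moment x)).comp (mfderiv I IG P.moment x))

/-- The Dirac structure `L ⊆ TM ⊕ T*M` corresponding to `π`, whose fibre at `x` consists of the
pairs `(π^♯(α) + ρ_M(v), C^*(α) + J^*σ(v))` with `α ∈ T*_x M` and `v ∈ 𝔤`. -/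
def dirac (x : M) : Submodule ℝ (TangentSpace I x × Cotangent I x) where
  carrier := {p | ∃ (α : Cotangent I x) (v : GroupLieAlgebra IG G),
    p = (P.bivector.sharp x α + P.action.toFun x v,
      α.comp (P.operatorC x) + codifferential I IG P.moment x (B.sigma (P.moment x) v))}
  add_mem' := by
    rintro _ _ ⟨α, v, rfl⟩ ⟨β, w, rfl⟩
    refine ⟨α + β, v + w, ?_⟩
    simp only [Prod.mk_add_mk, map_add, ContinuousLinearMap.add_comp, B.sigma_add, codifferential]
    congr 1 <;> abel
  zero_mem' := by
    refine ⟨0, 0, ?_⟩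
    have h : B.sigma (P.moment x) 0 = 0 := by simpa using B.sigma_smul (P.moment x) 0 0
    simp [h, codifferential]
    rfl
  smul_mem' := by
    rintro c _ ⟨α, v, rfl⟩
    refine ⟨c • α, c • v, ?_⟩
    simp only [Prod.smul_mk, map_smul, smul_add, ContinuousLinearMap.smul_comp, B.sigma_smul,
      codifferential]

end HamiltonianQuasiPoissonManifold

end Structures

section Maps

variable {EG HG : Type*} [NormedAddCommGroup EG] [NormedSpace ℝ EG] [TopologicalSpace HG]
  {IG : ModelWithCorners ℝ EG HG} {G : Type*} [TopologicalSpace G] [ChartedSpace HG G] [Group G]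
  [FiniteDimensional ℝ EG]
  {E₁ H₁ : Type*} [NormedAddCommGroup E₁] [NormedSpace ℝ E₁] [TopologicalSpace H₁]
  {I₁ : ModelWithCorners ℝ E₁ H₁} {M₁ : Type*} [TopologicalSpace M₁] [ChartedSpace H₁ M₁]
  {E₂ H₂ : Type*} [NormedAddCommGroup E₂] [NormedSpace ℝ E₂] [TopologicalSpace H₂]
  {I₂ : ModelWithCorners ℝ E₂ H₂} {M₂ : Type*} [TopologicalSpace M₂] [ChartedSpace H₂ M₂]

/-- `f` is forward Dirac: at each point `x` of the source,
`L₂ = {(df(Y), α) | (Y, df^* α) ∈ L₁}`. -/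
def IsForwardDirac (L₁ : (x : M₁) → Submodule ℝ (TangentSpace I₁ x × Cotangent I₁ x))
    (L₂ : (y : M₂) → Submodule ℝ (TangentSpace I₂ y × Cotangent I₂ y))
    (f : C^∞⟮I₁, M₁; I₂, M₂⟯) : Prop :=
  ∀ x : M₁, (L₂ (f x) : Set (TangentSpace I₂ (f x) × Cotangent I₂ (f x))) =
    {p | ∃ (Y : TangentSpace I₁ x) (α : Cotangent I₂ (f x)),
      (Y, codifferential I₁ I₂ f x α) ∈ L₁ x ∧ p = (mfderiv I₁ I₂ f x Y, α)}

variable [IsManifold I₁ ∞ M₁] [IsManifold I₂ ∞ M₂]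

/-- `f` is a hamiltonian quasi-Poisson map. -/
structure IsHamiltonianQuasiPoissonMap {B : InvariantForm IG G}
    (P₁ : HamiltonianQuasiPoissonManifold I₁ M₁ B)
    (P₂ : HamiltonianQuasiPoissonManifold I₂ M₂ B) (f : C^∞⟮I₁, M₁; I₂, M₂⟯) : Prop where
  /-- `f_* π₁ = π₂`: the bivector fields are `f`-related -/
  map_bivector : ∀ (x : M₁) (α β : Cotangent I₂ (f x)),
    P₁.bivector.eval x (codifferential I₁ I₂ f x α) (codifferential I₁ I₂ f x β) =
      P₂.bivector.eval (f x) α β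
  /-- `f` is `𝔤`-equivariant -/
  equivariant : ∀ (x : M₁) (v : GroupLieAlgebra IG G),
    mfderiv I₁ I₂ f x (P₁.action.toFun x v) = P₂.action.toFun (f x) v
  /-- `J₂ ∘ f = J₁` -/
  moment_comp : P₂.moment ∘ f = P₁.moment

end Maps

end QuasiPoisson

end

namespace QuasiPoisson

open scoped Manifold ContDiff

/-! ### Translations on the group. -/

section Translations

variable {E H : Type*} [NormedAddCommGroup E] [NormedSpace ℝ E] [TopologicalSpace H]
  {I : ModelWithCorners ℝ E H} {G : Type*} [TopologicalSpace G] [ChartedSpace H G] [Group G]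
  [LieGroup I ∞ G]

/-! Two facts about `L` carry the proof. First, `L` equals its own orthogonal for the pairing `η(X')
+ η'(X)` (`pairing_eq_zero`, `mem_dirac_of_forall_pairing_eq_zero`). Second, a vector `X` with `(X,
η) ∈ L` is determined by `η` and `dJ X` (`eq_of_mem_dirac`). Both reduce to identities on `G` that
follow from `Ad`-invariance: `σ(v)` kills `ρ(v)`, `σ^∨σ + ¼ρ^∨ρ = 1`, and `σρ^∨` and `σ^∨(ρ^∨)^*`
are skew.

If `f` is hamiltonian quasi-Poisson, it intertwines `C₁` and `C₂`, so each generator of `L₂` lifts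
to one of `L₁`: the forward image of `L₁` contains `L₂`. That image is isotropic and `L₂` is maximal
isotropic, so they coincide.

Conversely, push the generators `(ρ₁(v), J₁^*σ(v))` into `L₂` and compare them with `(ρ₂(v),
J₂^*σ(v))`. The covectors and the images under `dJ₂` agree, so separation gives equivariance. Then
`C₁` and `C₂` are intertwined, and the same comparison of the generators `(π^♯α, C^*α)` relates the
bivectors. -/

theorem hasMFDerivAt_mul_right (g : G) {a b : G} (hab : a = b) :
    HasMFDerivAt I I (fun h : G => h * g) b (mfderiv I I (fun h : G => h * g) a) := by
  subst hab
  have : ContMDiffMul I ∞ G := inferInstance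
  exact ((contMDiff_mul_right (I := I) (n := ∞) (a := g)).mdifferentiableAt
    (by simp)).hasMFDerivAt

theorem hasMFDerivAt_mul_left (g : G) {a b : G} (hab : a = b) :
    HasMFDerivAt I I (fun h : G => g * h) b (mfderiv I I (fun h : G => g * h) a) := by
  subst hab
  have : ContMDiffMul I ∞ G := inferInstance
  exact ((contMDiff_mul_left (I := I) (n := ∞) (a := g)).mdifferentiableAt
    (by simp)).hasMFDerivAt

theorem rightTransInv_rightTrans (g : G) (v : GroupLieAlgebra I G) :
    rightTransInv I g (rightTrans I g v) = v := by
  have h1 := hasMFDerivAt_mul_right (I := I) g (Eq.refl (1 : G))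
  -- The chain rule needs the derivative at `1 * g`, whereas `rightTransInv` is taken at `g`; the
  -- argument `a = b` bridges the two.
  have h2 : HasMFDerivAt I I (fun h : G => h * g⁻¹) (1 * g) (rightTransInv I g) :=
    hasMFDerivAt_mul_right g⁻¹ (one_mul g).symm
  have h3 := h2.comp 1 h1
  have h4 : (fun h : G => h * g⁻¹) ∘ (fun h : G => h * g) = id := by ext; simp
  rw [h4] at h3
  exact DFunLike.congr_fun (hasMFDerivAt_unique h3 (hasMFDerivAt_id 1)) v

theorem rightTrans_rightTransInv (g : G) (W : TangentSpace I g) :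
    rightTrans I g (rightTransInv I g W) = W := by
  have h1 := hasMFDerivAt_mul_right (I := I) g⁻¹ (Eq.refl (g : G))
  have h2 : HasMFDerivAt I I (fun h : G => h * g) (g * g⁻¹) (rightTrans I g) :=
    hasMFDerivAt_mul_right g (mul_inv_cancel g).symm
  have h3 := h2.comp g h1
  have h4 : (fun h : G => h * g) ∘ (fun h : G => h * g⁻¹) = id := by ext; simp
  rw [h4] at h3
  exact DFunLike.congr_fun (hasMFDerivAt_unique h3 (hasMFDerivAt_id g)) W

theorem leftTransInv_leftTrans (g : G) (v : GroupLieAlgebra I G) :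
    leftTransInv I g (leftTrans I g v) = v := by
  have h1 := hasMFDerivAt_mul_left (I := I) g (Eq.refl (1 : G))
  have h2 : HasMFDerivAt I I (fun h : G => g⁻¹ * h) (g * 1) (leftTransInv I g) :=
    hasMFDerivAt_mul_left g⁻¹ (mul_one g).symm
  have h3 := h2.comp 1 h1
  have h4 : (fun h : G => g⁻¹ * h) ∘ (fun h : G => g * h) = id := by ext; simp
  rw [h4] at h3
  exact DFunLike.congr_fun (hasMFDerivAt_unique h3 (hasMFDerivAt_id 1)) v

theorem leftTrans_leftTransInv (g : G) (W : TangentSpace I g) :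
    leftTrans I g (leftTransInv I g W) = W := by
  have h1 := hasMFDerivAt_mul_left (I := I) g⁻¹ (Eq.refl (g : G))
  have h2 : HasMFDerivAt I I (fun h : G => g * h) (g⁻¹ * g) (leftTrans I g) :=
    hasMFDerivAt_mul_left g (inv_mul_cancel g).symm
  have h3 := h2.comp g h1
  have h4 : (fun h : G => g * h) ∘ (fun h : G => g⁻¹ * h) = id := by ext; simp
  rw [h4] at h3
  exact DFunLike.congr_fun (hasMFDerivAt_unique h3 (hasMFDerivAt_id g)) W

theorem adjointAction_eq (g : G) (v : GroupLieAlgebra I G) :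
    adjointAction I g v = rightTransInv I g (leftTrans I g v) := by
  have h1 := hasMFDerivAt_mul_left (I := I) g (Eq.refl (1 : G))
  have h2 : HasMFDerivAt I I (fun h : G => h * g⁻¹) (g * 1) (rightTransInv I g) :=
    hasMFDerivAt_mul_right g⁻¹ (mul_one g).symm
  exact DFunLike.congr_fun (h2.comp 1 h1).mfderiv v

end Translations

/-! ### Identities for `ρ`, `σ` and their duals on `G`. -/

namespace InvariantForm

variable {E H : Type*} [NormedAddCommGroup E] [NormedSpace ℝ E] [FiniteDimensional ℝ E]
  [TopologicalSpace H] {I : ModelWithCorners ℝ E H}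
  {G : Type*} [TopologicalSpace G] [ChartedSpace H G] [Group G] (B : InvariantForm I G)

theorem form_dualElement (μ : GroupLieAlgebra I G →L[ℝ] ℝ) (v : GroupLieAlgebra I G) :
    B.form (B.dualElement μ) v = μ v := by
  have : FiniteDimensional ℝ (GroupLieAlgebra I G) := inferInstanceAs (FiniteDimensional ℝ E)
  exact LinearMap.BilinForm.apply_toDual_symm_apply (B := B.form) (hB := B.nondegenerate)
    μ.toLinearMap v

theorem eq_dualElement {μ : GroupLieAlgebra I G →L[ℝ] ℝ} {u : GroupLieAlgebra I G}
    (h : ∀ v, μ v = B.form u v) : B.dualElement μ = u := by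
  have : FiniteDimensional ℝ (GroupLieAlgebra I G) := inferInstanceAs (FiniteDimensional ℝ E)
  rw [dualElement, LinearEquiv.symm_apply_eq]
  ext v
  exact h v

variable [LieGroup I ∞ G]

/-- `r_{g⁻¹} l_g = Ad_g` has adjoint `l_{g⁻¹} r_g`. -/
theorem form_leftTransInv_rightTrans (g : G) (u v : GroupLieAlgebra I G) :
    B.form (leftTransInv I g (rightTrans I g u)) v
      = B.form u (rightTransInv I g (leftTrans I g v)) := by
  rw [← B.invariant g, adjointAction_eq, adjointAction_eq, leftTrans_leftTransInv,
    rightTransInv_rightTrans]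

theorem form_sigmaDual (g : G) (ξ : Cotangent I g) (v : GroupLieAlgebra I G) :
    B.form (B.sigmaDual g ξ) v = (1 / 2 : ℝ) * (ξ (rightTrans I g v) + ξ (leftTrans I g v)) := by
  simp only [sigmaDual, raise, map_smul, map_add, LinearMap.smul_apply, LinearMap.add_apply,
    smul_eq_mul, rightTransInv_rightTrans, form_leftTransInv_rightTrans, form_dualElement,
    ContinuousLinearMap.comp_apply, rightTrans_rightTransInv]

/-- In the right trivialization the value is `½(v + Ad_g v, v - Ad_g v)`, half the difference of the
squares of `v` and `Ad_g v`. -/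
theorem sigma_conjugation_self (g : G) (v : GroupLieAlgebra I G) :
    B.sigma g v (conjugation I g v) = 0 := by
  have h := B.invariant g v v
  have h' := B.symm (rightTransInv I g (leftTrans I g v)) v
  simp only [adjointAction_eq] at h
  simp only [sigma_apply, conjugation, _root_.sub_apply, map_add, map_sub,
    LinearMap.add_apply, rightTransInv_rightTrans]
  linarith

/-- With `A = Ad_g`, the two terms are `¼(2 + A + A⁻¹)v` and `¼(2 - A - A⁻¹)v`. This accounts for
the factor `¼` in `C`. -/
theorem sigmaDual_sigma (g : G) (v : GroupLieAlgebra I G) :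
    B.sigmaDual g (B.sigma g v) + (1 / 4 : ℝ) • conjugationDual I g (conjugation I g v) = v := by
  have h : B.dualElement ((B.sigma g v).comp (rightTrans I g))
      = (1 / 2 : ℝ) • (v + rightTransInv I g (leftTrans I g v)) := by
    apply eq_dualElement
    intro w
    simp only [ContinuousLinearMap.comp_apply, sigma_apply, map_add, map_smul,
      LinearMap.smul_apply, smul_eq_mul, rightTransInv_rightTrans]
  simp only [sigmaDual, raise, h, conjugation, conjugationDual, _root_.sub_apply,
    map_add, map_sub, map_smul, rightTransInv_rightTrans, rightTrans_rightTransInv,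
    leftTransInv_leftTrans]
  module

/-- The composition `σ ρ^∨ : T_g G → T*_g G` is skew. -/
theorem sigma_conjugationDual_skew (g : G) (U W : TangentSpace I g) :
    B.sigma g (conjugationDual I g U) W = -B.sigma g (conjugationDual I g W) U := by
  obtain ⟨u, rfl⟩ : ∃ u, rightTrans I g u = U := ⟨_, rightTrans_rightTransInv g U⟩
  obtain ⟨w, rfl⟩ : ∃ w, rightTrans I g w = W := ⟨_, rightTrans_rightTransInv g W⟩
  simp only [sigma_apply, conjugationDual, _root_.sub_apply, map_add, map_sub,
    LinearMap.add_apply, LinearMap.sub_apply, rightTransInv_rightTrans, leftTrans_leftTransInv,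
    form_leftTransInv_rightTrans]
  linarith [B.symm u w, B.symm u (rightTransInv I g (leftTrans I g w)),
    B.symm w (rightTransInv I g (leftTrans I g u))]

/-- The composition of `σ^∨` with the transpose `𝔤* → T*_g G` of `ρ^∨` is skew. -/
theorem conjugationDual_sigmaDual_self (g : G) (a : GroupLieAlgebra I G →L[ℝ] ℝ) :
    a (B.sigmaDual g (a.comp (conjugationDual I g))) = 0 := by
  rw [← B.form_dualElement, B.symm, form_sigmaDual]
  simp only [ContinuousLinearMap.comp_apply, ← B.form_dualElement a]
  set d := B.dualElement a
  simp only [conjugationDual, _root_.sub_apply, map_sub, rightTransInv_rightTrans,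
    leftTransInv_leftTrans]
  rw [B.symm d (leftTransInv I g _), form_leftTransInv_rightTrans]
  ring

end InvariantForm

theorem eq_of_forall_apply_eq {V : Type*} [NormedAddCommGroup V] [NormedSpace ℝ V] {u w : V}
    (h : ∀ α : V →L[ℝ] ℝ, α u = α w) : u = w :=
  (SeparatingDual.eq_iff_forall_dual_eq (R := ℝ)).2 h

theorem eq_of_forall_cotangent_apply_eq {E H : Type*} [NormedAddCommGroup E] [NormedSpace ℝ E]
    [TopologicalSpace H] {I : ModelWithCorners ℝ E H} {M : Type*} [TopologicalSpace M]
    [ChartedSpace H M] {x : M} {u w : TangentSpace I x}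
    (h : ∀ α : Cotangent I x, α u = α w) : u = w :=
  eq_of_forall_apply_eq (V := E) h

/-! ### `L` is maximal isotropic and, with `dJ`, separates vectors. -/

namespace HamiltonianQuasiPoissonManifold

variable {EG HG : Type*} [NormedAddCommGroup EG] [NormedSpace ℝ EG] [TopologicalSpace HG]
  {IG : ModelWithCorners ℝ EG HG} {G : Type*} [TopologicalSpace G] [ChartedSpace HG G] [Group G]
  {E H : Type*} [NormedAddCommGroup E] [NormedSpace ℝ E] [TopologicalSpace H]
  {I : ModelWithCorners ℝ E H} {M : Type*} [TopologicalSpace M] [ChartedSpace H M]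
  [IsManifold I ∞ M] [FiniteDimensional ℝ EG]
  {B : InvariantForm IG G} (P : HamiltonianQuasiPoissonManifold I M B)

theorem operatorC_apply (x : M) (X : TangentSpace I x) :
    P.operatorC x X = X - (1 / 4 : ℝ) •
      P.action.toFun x (conjugationDual IG (P.moment x) (mfderiv I IG P.moment x X)) :=
  rfl

/-- The dual form of the moment map condition. -/
theorem apply_mfderiv_moment_sharp (x : M) (α : Cotangent I x)
    (ξ : Cotangent IG (P.moment x)) :
    ξ (mfderiv I IG P.moment x (P.bivector.sharp x α))
      = -α (P.action.toFun x (B.sigmaDual (P.moment x) ξ)) := by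
  rw [← P.moment_condition]
  exact P.bivector.skew x α (codifferential I IG P.moment x ξ)

theorem sharp_self (x : M) (α : Cotangent I x) : α (P.bivector.sharp x α) = 0 := by
  linarith [P.bivector.skew x α α]

theorem mk_mem_dirac (x : M) (α : Cotangent I x) (v : GroupLieAlgebra IG G) :
    (P.bivector.sharp x α + P.action.toFun x v,
      α.comp (P.operatorC x) + codifferential I IG P.moment x (B.sigma (P.moment x) v))
      ∈ P.dirac x :=
  ⟨α, v, rfl⟩

theorem action_mem_dirac (x : M) (v : GroupLieAlgebra IG G) :
    (P.action.toFun x v, codifferential I IG P.moment x (B.sigma (P.moment x) v))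
      ∈ P.dirac x := by
  simpa using P.mk_mem_dirac x 0 v

theorem sharp_mem_dirac (x : M) (α : Cotangent I x) :
    (P.bivector.sharp x α, α.comp (P.operatorC x)) ∈ P.dirac x := by
  have h : B.sigma (P.moment x) 0 = 0 := by simpa using B.sigma_smul (P.moment x) 0 0
  have h' := P.mk_mem_dirac x α 0
  have h0 : codifferential I IG P.moment x 0 = 0 := rfl
  rw [h, map_zero, add_zero, h0, add_zero] at h'
  exact h'

variable [LieGroup IG ∞ G]

/-- Expanding in `α` and `v`, the part quadratic in `α` vanishes by skewness of `π` and of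
`σ^∨(ρ^∨)^*`. The mixed part is `α(ρ_M(v - ¼ρ^∨ρ(v) - σ^∨σ(v))) = 0`, and the part quadratic in `v`
is `σ(v)(ρ(v)) = 0`. -/
theorem pairing_self_eq_zero (x : M) {p : TangentSpace I x × Cotangent I x}
    (hp : p ∈ P.dirac x) : p.2 p.1 = 0 := by
  obtain ⟨α, v, rfl⟩ := hp
  set J := mfderiv I IG P.moment x with hJ
  set ρ := P.action.toFun x with hρ
  have h1 : α (P.operatorC x (P.bivector.sharp x α)) = 0 := by
    have := P.apply_mfderiv_moment_sharp x α
      ((α.comp ρ).comp (conjugationDual IG (P.moment x)))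
    have h0 := B.conjugationDual_sigmaDual_self (P.moment x) (α.comp ρ)
    rw [ContinuousLinearMap.comp_apply] at h0
    rw [h0, neg_zero] at this
    rw [operatorC_apply, map_sub, map_smul, sharp_self]
    change _ - (1 / 4 : ℝ) * ((α.comp ρ).comp (conjugationDual IG (P.moment x)))
      (J (P.bivector.sharp x α)) = 0
    rw [this]
    ring
  have h2 : α (P.operatorC x (ρ v)) + B.sigma (P.moment x) v (J (P.bivector.sharp x α)) = 0 := by
    rw [operatorC_apply, P.equivariant, P.apply_mfderiv_moment_sharp, ← sub_eq_add_neg,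
      ← map_sub, ← map_smul, ← map_sub, ← map_sub]
    have h0 := B.sigmaDual_sigma (P.moment x) v
    rw [← eq_sub_iff_add_eq] at h0
    rw [h0]
    simp
  have h3 : B.sigma (P.moment x) v (J (ρ v)) = 0 := by
    rw [hJ, hρ, P.equivariant]
    exact B.sigma_conjugation_self _ v
  change α (P.operatorC x (P.bivector.sharp x α + ρ v))
    + B.sigma (P.moment x) v (J (P.bivector.sharp x α + ρ v)) = 0
  simp only [map_add]
  linarith

/-- `L` is isotropic. -/
theorem pairing_eq_zero (x : M) {p q : TangentSpace I x × Cotangent I x}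
    (hp : p ∈ P.dirac x) (hq : q ∈ P.dirac x) : p.2 q.1 + q.2 p.1 = 0 := by
  -- Polarization.
  have h := P.pairing_self_eq_zero x ((P.dirac x).add_mem hp hq)
  simp only [Prod.fst_add, Prod.snd_add, _root_.add_apply, map_add] at h
  linarith [P.pairing_self_eq_zero x hp, P.pairing_self_eq_zero x hq]

/-- `L` is maximal isotropic. -/
theorem mem_dirac_of_forall_pairing_eq_zero (x : M) {p : TangentSpace I x × Cotangent I x}
    (hp : ∀ q ∈ P.dirac x, p.2 q.1 + q.2 p.1 = 0) : p ∈ P.dirac x := by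
  obtain ⟨X, η⟩ := p
  have h1 : P.operatorC x X = P.bivector.sharp x η := by
    apply eq_of_forall_cotangent_apply_eq
    intro α
    have h := hp _ (P.sharp_mem_dirac x α)
    have h' := P.bivector.skew x α η
    simp only [ContinuousLinearMap.comp_apply] at h
    linarith
  have h2 (v) : η (P.action.toFun x v)
      = -B.sigma (P.moment x) v (mfderiv I IG P.moment x X) := by
    have h := hp _ (P.action_mem_dirac x v)
    change η _ + B.sigma (P.moment x) v (mfderiv I IG P.moment x X) = 0 at h
    linarith
  -- The witnesses come from solving `C X = π^♯η` for `X`, with the definition of `C` written out.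
  -- No dimension count is needed.
  refine ⟨η, (1 / 4 : ℝ) • conjugationDual IG (P.moment x) (mfderiv I IG P.moment x X), ?_⟩
  refine Prod.ext ?_ ?_
  · simp only [← h1, operatorC_apply, map_smul, sub_add_cancel]
  · ext Y
    change η Y = η (P.operatorC x Y) + B.sigma (P.moment x) _ (mfderiv I IG P.moment x Y)
    -- `η(Y) - η(C Y) = ¼η(ρ_M ρ^∨ dJ Y)`; `h2` turns this into `σρ^∨`, whose skewness exchanges `X`
    -- and `Y`.
    rw [operatorC_apply, map_sub, map_smul, h2, B.sigma_smul, B.sigma_conjugationDual_skew]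
    simp

/-- A vector in `L ∩ TM` that is vertical for the moment map vanishes. -/
theorem eq_zero_of_mem_dirac (x : M) {X : TangentSpace I x} (hX : (X, 0) ∈ P.dirac x)
    (hJ : mfderiv I IG P.moment x X = 0) : X = 0 := by
  apply eq_of_forall_cotangent_apply_eq
  intro α
  -- Isotropy gives `α(C X) = 0`, and `C X = X` because `dJ X = 0`.
  have h := P.pairing_eq_zero x hX (P.sharp_mem_dirac x α)
  simpa [operatorC_apply, hJ] using h

/-- `L` and the differential of the moment map separate tangent vectors. -/
theorem eq_of_mem_dirac (x : M) {X Y : TangentSpace I x} {η : Cotangent I x}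
    (hX : (X, η) ∈ P.dirac x) (hY : (Y, η) ∈ P.dirac x)
    (hJ : mfderiv I IG P.moment x X = mfderiv I IG P.moment x Y) : X = Y := by
  have h := (P.dirac x).sub_mem hX hY
  rw [Prod.mk_sub_mk, sub_self] at h
  exact sub_eq_zero.1 (P.eq_zero_of_mem_dirac x h (by rw [map_sub, hJ, sub_self]))

end HamiltonianQuasiPoissonManifold

/-! ### Maps compatible with the moment maps. -/

section Maps

variable {EG HG : Type*} [NormedAddCommGroup EG] [NormedSpace ℝ EG] [TopologicalSpace HG]
  {IG : ModelWithCorners ℝ EG HG} {G : Type*} [TopologicalSpace G] [ChartedSpace HG G] [Group G]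
  [FiniteDimensional ℝ EG]
  {E₁ H₁ : Type*} [NormedAddCommGroup E₁] [NormedSpace ℝ E₁] [TopologicalSpace H₁]
  {I₁ : ModelWithCorners ℝ E₁ H₁} {M₁ : Type*} [TopologicalSpace M₁] [ChartedSpace H₁ M₁]
  {E₂ H₂ : Type*} [NormedAddCommGroup E₂] [NormedSpace ℝ E₂] [TopologicalSpace H₂]
  {I₂ : ModelWithCorners ℝ E₂ H₂} {M₂ : Type*} [TopologicalSpace M₂] [ChartedSpace H₂ M₂]
  [IsManifold I₁ ∞ M₁] [IsManifold I₂ ∞ M₂] {B : InvariantForm IG G}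
  {P₁ : HamiltonianQuasiPoissonManifold I₁ M₁ B} {P₂ : HamiltonianQuasiPoissonManifold I₂ M₂ B}
  {f : C^∞⟮I₁, M₁; I₂, M₂⟯}

/-- The points `J₂(f x)` and `J₁(x)` are equal but not definitionally so; this and its analogues
compare data at them inside the common model space `EG`. -/
theorem InvariantForm.sigma_congr {g g' : G} (h : g = g') (v : GroupLieAlgebra IG G) (W : EG) :
    (B.sigma g v : EG →L[ℝ] ℝ) W = (B.sigma g' v : EG →L[ℝ] ℝ) W := by
  subst h; rfl

theorem InvariantForm.sigmaDual_congr {g g' : G} (h : g = g') (ξ : EG →L[ℝ] ℝ) :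
    B.sigmaDual g (show Cotangent IG g from ξ) = B.sigmaDual g' (show Cotangent IG g' from ξ) := by
  subst h; rfl

theorem conjugation_congr {g g' : G} (h : g = g') (v : GroupLieAlgebra IG G) :
    (conjugation IG g v : EG) = conjugation IG g' v := by
  subst h; rfl

theorem conjugationDual_congr {g g' : G} (h : g = g') (W : EG) :
    conjugationDual IG g (show TangentSpace IG g from W)
      = conjugationDual IG g' (show TangentSpace IG g' from W) := by
  subst h; rfl

theorem mfderiv_moment_apply_of_comp_eq (hJ : P₂.moment ∘ f = P₁.moment) (x : M₁)
    (X : TangentSpace I₁ x) :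
    (mfderiv I₁ IG P₁.moment x X : EG)
      = mfderiv I₂ IG P₂.moment (f x) (mfderiv I₁ I₂ f x X) := by
  have h2 : MDifferentiableAt I₂ IG P₂.moment (f x) :=
    P₂.moment.contMDiff.mdifferentiableAt (by simp)
  have h1 : MDifferentiableAt I₁ I₂ f x := f.contMDiff.mdifferentiableAt (by simp)
  rw [← hJ]
  exact DFunLike.congr_fun (mfderiv_comp x h2 h1) X

theorem codifferential_sigma_of_comp_eq (hJ : P₂.moment ∘ f = P₁.moment) (x : M₁)
    (v : GroupLieAlgebra IG G) :
    codifferential I₁ I₂ f x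
        (codifferential I₂ IG P₂.moment (f x) (B.sigma (P₂.moment (f x)) v))
      = codifferential I₁ IG P₁.moment x (B.sigma (P₁.moment x) v) := by
  ext X
  refine (InvariantForm.sigma_congr (B := B) (congrFun hJ x) v _).trans ?_
  exact congrArg (B.sigma (P₁.moment x) v : EG →L[ℝ] ℝ)
    (mfderiv_moment_apply_of_comp_eq hJ x X).symm

/-- The operators `C₁` and `C₂` are related by an equivariant map that respects moment maps. -/
theorem mfderiv_operatorC (hJ : P₂.moment ∘ f = P₁.moment) (x : M₁)
    (hρ : ∀ v : GroupLieAlgebra IG G,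
      mfderiv I₁ I₂ f x (P₁.action.toFun x v) = P₂.action.toFun (f x) v)
    (X : TangentSpace I₁ x) :
    mfderiv I₁ I₂ f x (P₁.operatorC x X) = P₂.operatorC (f x) (mfderiv I₁ I₂ f x X) := by
  rw [P₁.operatorC_apply, P₂.operatorC_apply, map_sub, map_smul, hρ]
  have h : conjugationDual IG (P₁.moment x) (mfderiv I₁ IG P₁.moment x X)
      = conjugationDual IG (P₂.moment (f x))
        (mfderiv I₂ IG P₂.moment (f x) (mfderiv I₁ I₂ f x X)) :=
    (congrArg (conjugationDual IG (P₁.moment x) : EG →L[ℝ] EG)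
      (mfderiv_moment_apply_of_comp_eq hJ x X)).trans
      (conjugationDual_congr (congrFun hJ x).symm _)
  rw [h]

theorem codifferential_comp_operatorC (hJ : P₂.moment ∘ f = P₁.moment) (x : M₁)
    (hρ : ∀ v : GroupLieAlgebra IG G,
      mfderiv I₁ I₂ f x (P₁.action.toFun x v) = P₂.action.toFun (f x) v)
    (α : Cotangent I₂ (f x)) :
    codifferential I₁ I₂ f x (α.comp (P₂.operatorC (f x)))
      = (codifferential I₁ I₂ f x α).comp (P₁.operatorC x) := by
  ext X
  exact congrArg α (mfderiv_operatorC hJ x hρ X).symm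

theorem IsHamiltonianQuasiPoissonMap.mfderiv_sharp (h : IsHamiltonianQuasiPoissonMap P₁ P₂ f)
    (x : M₁) (α : Cotangent I₂ (f x)) :
    mfderiv I₁ I₂ f x (P₁.bivector.sharp x (codifferential I₁ I₂ f x α))
      = P₂.bivector.sharp (f x) α :=
  eq_of_forall_cotangent_apply_eq fun β => h.map_bivector x α β

variable [LieGroup IG ∞ G]

theorem IsHamiltonianQuasiPoissonMap.isForwardDirac
    (h : IsHamiltonianQuasiPoissonMap P₁ P₂ f) : IsForwardDirac P₁.dirac P₂.dirac f := by
  intro x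
  have hsub : ∀ q ∈ P₂.dirac (f x), ∃ (Y : TangentSpace I₁ x) (α : Cotangent I₂ (f x)),
      (Y, codifferential I₁ I₂ f x α) ∈ P₁.dirac x ∧ q = (mfderiv I₁ I₂ f x Y, α) := by
    rintro _ ⟨α, v, rfl⟩
    refine ⟨P₁.bivector.sharp x (codifferential I₁ I₂ f x α) + P₁.action.toFun x v, _, ?_,
      Prod.ext ?_ rfl⟩
    · convert P₁.mk_mem_dirac x (codifferential I₁ I₂ f x α) v using 2
      rw [← codifferential_sigma_of_comp_eq h.moment_comp,
        ← codifferential_comp_operatorC h.moment_comp x (h.equivariant x)]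
      rfl
    · simp only [map_add, h.mfderiv_sharp, h.equivariant]
  refine Set.Subset.antisymm hsub ?_
  rintro _ ⟨Y, α, hY, rfl⟩
  -- Every `q ∈ L₂` lifts to `L₁`, and the pairing of two pushed-forward elements equals that of
  -- their lifts, which is zero.
  refine P₂.mem_dirac_of_forall_pairing_eq_zero (f x) fun q hq => ?_
  obtain ⟨Z, β, hZ, rfl⟩ := hsub q hq
  exact P₁.pairing_eq_zero x hY hZ

/-- Only the inclusion of the forward image of `L₁` in `L₂` enters; separation of vectors does the
rest. -/
theorem IsForwardDirac.isHamiltonianQuasiPoissonMap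
    (h : IsForwardDirac P₁.dirac P₂.dirac f) (hJ : P₂.moment ∘ f = P₁.moment) :
    IsHamiltonianQuasiPoissonMap P₁ P₂ f := by
  have hmem (x : M₁) (Y : TangentSpace I₁ x) (α : Cotangent I₂ (f x))
      (hY : (Y, codifferential I₁ I₂ f x α) ∈ P₁.dirac x) :
      (mfderiv I₁ I₂ f x Y, α) ∈ P₂.dirac (f x) := by
    have : (mfderiv I₁ I₂ f x Y, α)
        ∈ (P₂.dirac (f x) : Set (TangentSpace I₂ (f x) × Cotangent I₂ (f x))) := by
      rw [h x]
      exact ⟨Y, α, hY, rfl⟩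
    exact this
  have hρ (x : M₁) (v : GroupLieAlgebra IG G) :
      mfderiv I₁ I₂ f x (P₁.action.toFun x v) = P₂.action.toFun (f x) v := by
    refine P₂.eq_of_mem_dirac (f x) (hmem x _ _ ?_) (P₂.action_mem_dirac (f x) v) ?_
    · rw [codifferential_sigma_of_comp_eq hJ]
      exact P₁.action_mem_dirac x v
    · refine (mfderiv_moment_apply_of_comp_eq hJ x _).symm.trans ?_
      rw [P₂.equivariant]
      exact Eq.trans (P₁.equivariant x v) (conjugation_congr (congrFun hJ x).symm v)
  refine ⟨fun x α β => ?_, hρ, hJ⟩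
  suffices hs : mfderiv I₁ I₂ f x (P₁.bivector.sharp x (codifferential I₁ I₂ f x α))
      = P₂.bivector.sharp (f x) α from congrArg β hs
  refine P₂.eq_of_mem_dirac (f x) (hmem x _ _ ?_) (P₂.sharp_mem_dirac (f x) α) ?_
  -- Equivariance must come first: it is what gives `f^*C₂^*α = C₁^*f^*α`.
  · rw [codifferential_comp_operatorC hJ x (hρ x)]
    exact P₁.sharp_mem_dirac x _
  · refine (mfderiv_moment_apply_of_comp_eq hJ x _).symm.trans ?_
    -- Tested on `ξ`, the moment condition turns both sides into `-α(ρ₂ σ^∨(ξ))`, using equivariance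
    -- once more.
    refine eq_of_forall_apply_eq (V := EG) fun ξ => ?_
    refine Eq.trans (P₁.apply_mfderiv_moment_sharp x _ ξ)
      (Eq.trans ?_ (P₂.apply_mfderiv_moment_sharp (f x) α ξ).symm)
    refine congrArg Neg.neg (congrArg α ?_)
    refine (hρ x _).trans (congrArg _ ?_)
    exact InvariantForm.sigmaDual_congr (congrFun hJ x).symm ξ

end Maps

end QuasiPoisson

theorem mainTheorem7
    {EG HG : Type*} [NormedAddCommGroup EG] [NormedSpace ℝ EG] [FiniteDimensional ℝ EG]
    [TopologicalSpace HG] (IG : ModelWithCorners ℝ EG HG) [IG.Boundaryless]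
    {G : Type*} [TopologicalSpace G] [ChartedSpace HG G] [Group G] [LieGroup IG ∞ G]
    (B : QuasiPoisson.InvariantForm IG G)
    {E₁ H₁ : Type*} [NormedAddCommGroup E₁] [NormedSpace ℝ E₁] [FiniteDimensional ℝ E₁]
    [TopologicalSpace H₁] (I₁ : ModelWithCorners ℝ E₁ H₁) [I₁.Boundaryless]
    {M₁ : Type*} [TopologicalSpace M₁] [T2Space M₁] [ChartedSpace H₁ M₁] [IsManifold I₁ ∞ M₁]
    {E₂ H₂ : Type*} [NormedAddCommGroup E₂] [NormedSpace ℝ E₂] [FiniteDimensional ℝ E₂]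
    [TopologicalSpace H₂] (I₂ : ModelWithCorners ℝ E₂ H₂) [I₂.Boundaryless]
    {M₂ : Type*} [TopologicalSpace M₂] [T2Space M₂] [ChartedSpace H₂ M₂] [IsManifold I₂ ∞ M₂]
    (P₁ : QuasiPoisson.HamiltonianQuasiPoissonManifold I₁ M₁ B)
    (P₂ : QuasiPoisson.HamiltonianQuasiPoissonManifold I₂ M₂ B)
    (f : C^∞⟮I₁, M₁; I₂, M₂⟯) :
    QuasiPoisson.IsHamiltonianQuasiPoissonMap P₁ P₂ f ↔
      QuasiPoisson.IsForwardDirac P₁.dirac P₂.dirac f ∧ P₂.moment ∘ f = P₁.moment :=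
  ⟨fun h => ⟨h.isForwardDirac, h.moment_comp⟩, fun h => h.1.isHamiltonianQuasiPoissonMap h.2⟩
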